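/- **Setting.** Let $G=(V,E)$ be a finite directed graph with source $s$ and target $t$. Every edge $e$ has a lazy estimate $\hat w(e)>0$ and a true weight $w(e)$, where $w(e)=\hat w(e)$ if $e$ is collision-free and $w(e)=\infty$ if $e$ is in collision. Assume that no two distinct simple paths of $G$ starting at $s$ have the same total lazy weight. Fix a lookahead $\alpha\in\{1,2,\dots\}\cup\{\infty\}$ and a greediness $\beta\in\mathbb N$ with $1\le\beta\le\alpha$. **The algorithm LRA\* with lookahead $\alpha$ and greediness $\beta$.** It maintains a tree $T$ of paths from $s$, with at most one node per vertex. A node $\tau$ at a vertex $v$ stands for a path $P[\tau]$ from $s$ to $v$, which is split into a head (its longest initial part consisting of evaluated edges) and a tail (the rest). The budget $b[\tau]$ is the number of edges of the tail, and the key of $\tau$ is $w(\text{head})+\hat w(\text{tail})$. Edges found in collision are removed from the graph. * *Extending.* As long as possible, take a node $\tau\in T$ at a vertex $u\ne t$ with $b[\tau]<\alpha$ and a remaining edge $(u,v)$ such that $v$ has no node in $T$, or the path $P[\tau]\cdot(u,v)$ has a smaller key than the node of $v$; make $P[\tau]\cdot(u,v)$ the node of $v$, deleting the previous node of $v$ and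 its descendants. These operations may be done in any order. * *Start.* $T$ consists of the root $s$ only, no edge is evaluated, and $T$ is extended. * *Stopping.* A frontier node is a node of $T$ with budget $\alpha$, or the node of $t$. The algorithm stops when $T$ contains a node of $t$ with budget $0$ (success), or when there is no frontier node (failure). * *Iteration.* Otherwise choose a frontier node $\tau$ of minimal key and evaluate the first $\beta$ edges of its tail (all of them if there are fewer), one after the other, stopping at the first edge found in collision. Remove from $T$ all nodes whose path uses a removed edge, update heads, tails, budgets and keys, and extend $T$ again (this rewires the removed nodes to their best parents). **Lemma.** Let $1\le\beta\le\alpha_2<\alpha_1\le\infty$ with $\beta$ an integer and $\alpha_1\ge\alpha_2+\beta-1$. Then LRA\* with greediness $\beta$ has complete (terminating) runs with lookahead $\alpha_1$ and with lookahead $\alpha_2$, and if $E_i$ is the set of edges evaluated in any complete run with lookahead $\alpha_i$ and greediness $\beta$ $(i=1,2)$, then $E_1\subseteq E_2$. -/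

import Mathlib

open scoped NNReal ENNReal

/-- A shortest-path problem with expensive edges on a directed graph: a source, a target, a lazy
estimate `lazyWeight` of the edge weights and the true weights `weight`.  The estimate is tight on
the edges that are not in collision; the edges in collision have weight `∞`. -/
structure LazyProblem (V : Type*) where
  graph : Digraph V
  source : V
  target : V
  lazyWeight : V × V → ℝ≥0
  weight : V × V → ℝ≥0∞
  lazyWeight_pos : ∀ u v, graph.Adj u v → 0 < lazyWeight (u, v)
  weight_eq : ∀ u v, graph.Adj u v →
    weight (u, v) = (lazyWeight (u, v) : ℝ≥0∞) ∨ weight (u, v) = ∞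

namespace LazyProblem

variable {V : Type*} (P : LazyProblem V)

/-- The consecutive pairs (the edges) of a sequence of vertices. -/
def edges (p : List V) : List (V × V) := p.zip p.tail

/-- `p` is a path of the graph that starts at the source and repeats no vertex. -/
def IsSimplePathFromSource (p : List V) : Prop :=
  p.head? = some P.source ∧ p.IsChain P.graph.Adj ∧ p.Nodup

/-- The lazy cost of a list of edges. -/
noncomputable def lazyCost (l : List (V × V)) : ℝ≥0 := (l.map P.lazyWeight).sum

/-- The true cost of a list of edges. -/
noncomputable def trueCost (l : List (V × V)) : ℝ≥0∞ := (l.map P.weight).sum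

/-- No two distinct simple paths from the source have the same (lazy) weight. -/
def DistinctPathWeights : Prop :=
  ∀ p q : List V, P.IsSimplePathFromSource p → P.IsSimplePathFromSource q →
    P.lazyCost (edges p) = P.lazyCost (edges q) → p = q

/-- The edge `e` is collision free: its true weight is the estimated one. -/
def CollisionFree (e : V × V) : Prop := P.weight e = (P.lazyWeight e : ℝ≥0∞)

section Nodes

/-! A node `τ` of the search tree is represented by its path `P[τ]`, a list of vertices from the
source to the vertex of `τ`; its parent is the path without its last vertex.  The other entries of
a node are functions of this path and of the set `A` of edges evaluated so far. -/

open Classical in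
/-- The edges of the evaluated part `P[τ]_head`: the longest initial part of the path all of whose
edges have been evaluated. -/
noncomputable def headEdges (A : Set (V × V)) (p : List V) : List (V × V) :=
  (edges p).takeWhile (fun e => decide (e ∈ A))

open Classical in
/-- The edges of the lazily evaluated part `P[τ]_tail`. -/
noncomputable def tailEdges (A : Set (V × V)) (p : List V) : List (V × V) :=
  (edges p).dropWhile (fun e => decide (e ∈ A))

/-- The budget `b[τ]`. -/
noncomputable def budget (A : Set (V × V)) (p : List V) : ℕ := (tailEdges A p).length

/-- The key `c[τ] + ℓ[τ]` of a node: the true cost of the head plus the lazy cost of the tail. -/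
noncomputable def key (A : Set (V × V)) (p : List V) : ℝ≥0∞ :=
  P.trueCost (headEdges A p) + (P.lazyCost (tailEdges A p) : ℝ≥0∞)

end Nodes

/-- An edge is removed from the graph once it has been evaluated and found in collision. -/
def Removed (A : Set (V × V)) (e : V × V) : Prop := e ∈ A ∧ ¬ P.CollisionFree e

/-- One elementary operation on the search tree `T` (extension of a leaf, or rewiring of a node to
a better parent), with lookahead `α`, after the edges of `A` have been evaluated.  A node `p` of
`T` at a vertex `u` other than the target, whose budget is smaller than `α`, becomes the parent of
the vertex `v`, where `(u, v)` is an edge that has not been removed and `v` is either not yet in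
the tree or has a larger key there.  The previous node of `v` and its descendants are deleted. -/
def Relax (α : ℕ∞) (A : Set (V × V)) (T T' : Set (List V)) : Prop :=
  ∃ (p : List V) (u v : V), p ∈ T ∧ p.getLast? = some u ∧ u ≠ P.target ∧
    (budget A p : ℕ∞) < α ∧ P.graph.Adj u v ∧ ¬ P.Removed A (u, v) ∧
    (∀ q ∈ T, q.getLast? = some v → P.key A (p ++ [v]) < P.key A q) ∧
    T' = insert (p ++ [v]) {q ∈ T | v ∉ q}

/-- `T'` arises from `T` by elementary operations, in any order, carried out until none is
possible: then every successor of a node with budget smaller than `α` is in the tree (all leaves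
are frontier nodes), with a parent that cannot be improved. -/
def Extends (α : ℕ∞) (A : Set (V × V)) (T T' : Set (List V)) : Prop :=
  Relation.ReflTransGen (P.Relax α A) T T' ∧ ∀ T'', ¬ P.Relax α A T' T''

/-- The state of the algorithm at the beginning of an iteration. -/
structure State (V : Type*) where
  tree : Set (List V)
  evaluated : Set (V × V)

/-- The node `p` is in the frontier queue: its budget is `α`, or it is the node of the target. -/
def IsFrontier (α : ℕ∞) (S : State V) (p : List V) : Prop :=
  p ∈ S.tree ∧ ((budget S.evaluated p : ℕ∞) = α ∨ p.getLast? = some P.target)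

/-- The edges evaluated when the node `p` is chosen, with greediness `β`: the first `β` edges of
its tail, one after the other, until one of them is found in collision or the tail ends. -/
def evaluatedOn (β : ℕ) (A : Set (V × V)) (p : List V) : Set (V × V) :=
  {e | ∃ l₁ l₂, (tailEdges A p).take β = l₁ ++ e :: l₂ ∧ ∀ e' ∈ l₁, P.CollisionFree e'}

/-- The tree without the nodes whose path uses a removed edge, that is, without the nodes in the
subtrees that have to be rewired. -/
def prune (A : Set (V × V)) (T : Set (List V)) : Set (List V) :=
  {p ∈ T | ∀ e ∈ edges p, ¬ P.Removed A e}

/-- The target has been reached by a path that is completely evaluated. -/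
def TargetReached (S : State V) : Prop :=
  ∃ p ∈ S.tree, p.getLast? = some P.target ∧ budget S.evaluated p = 0

/-- Initialization: the tree is extended from the node of the source. -/
def IsInitial (α : ℕ∞) (S : State V) : Prop :=
  S.evaluated = ∅ ∧ P.Extends α ∅ {[P.source]} S.tree

/-- One iteration of the main loop: a frontier node of minimal key is chosen, edges along its tail
are evaluated, and the tree is updated, rewired and extended. -/
def Iteration (α : ℕ∞) (β : ℕ) (S S' : State V) : Prop :=
  ¬ P.TargetReached S ∧
  ∃ p, P.IsFrontier α S p ∧
    (∀ q, P.IsFrontier α S q → P.key S.evaluated p ≤ P.key S.evaluated q) ∧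
    S'.evaluated = S.evaluated ∪ P.evaluatedOn β S.evaluated p ∧
    P.Extends α S'.evaluated (P.prune S'.evaluated S.tree) S'.tree

/-- The algorithm stops when the target has been reached (success) or when the frontier queue is
empty (failure). -/
def Halted (α : ℕ∞) (S : State V) : Prop :=
  P.TargetReached S ∨ ∀ p, ¬ P.IsFrontier α S p

/-- `E` is the set of edges evaluated in a complete run of LRA* with lookahead `α` and
greediness `β`. -/
def LRAStarEvaluates (α : ℕ∞) (β : ℕ) (E : Set (V × V)) : Prop :=
  ∃ S₀ S : State V, P.IsInitial α S₀ ∧ Relation.ReflTransGen (P.Iteration α β) S₀ S ∧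
    P.Halted α S ∧ E = S.evaluated

end LazyProblem

/-! The key of a walk that uses no removed edge is its lazy cost, so a run only compares lazy costs.
The chosen frontier node is a geodesic, a cheapest walk in the graph without the removed edges: a
cheaper way to its end would leave the tree at a cheaper frontier node.  Hence every evaluated edge
starts at a vertex that is reached by a completely evaluated geodesic, and geodesics are unique as
the weights of simple paths are distinct.

Let `B` be the set of edges evaluated in a complete run with lookahead `α₂`, and suppose that a run
with lookahead `α₁` evaluates an edge `e ∉ B`. Consider the first iteration in which this happens,
and let `p` be the chosen path, so that all edges evaluated earlier are in `B`. The part of `p`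
before `e` is collision free. The first edge of `p` removed by `B` would start where a completely
evaluated geodesic ends, which is the part of `p` before it, so it would come before `e`; hence `p`
is still a geodesic at the end of the second run. At most `β - 1` edges of the tail of `p` precede
`e`, so the budget of `p` there is at least `α₁ - (β - 1) ≥ α₂`, unless `p` ends at the target. So
some frontier node is left and the second run ends with a completely evaluated path `z` to the
target. It is at most as expensive as `p`, because it was the last path chosen in the second run and
nothing was removed in that step; and `p` is at most as expensive as `z`, because it was chosen in
the first run. So `p = z`, although `e` lies on `p` but not on `z`. -/

section Lists

variable {ι : Type*} {f g : ι → Bool}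

theorem length_dropWhile_le_of_imp (h : ∀ x, f x → g x) (l : List ι) :
    (l.dropWhile g).length ≤ (l.dropWhile f).length := by
  induction l with
  | nil => rfl
  | cons a l ih =>
    by_cases hf : f a
    · simpa [hf, h a hf] using ih
    · rw [List.dropWhile_cons_of_neg hf]
      exact (List.dropWhile_sublist g).length_le

theorem length_dropWhile_concat_le (f : ι → Bool) (l : List ι) (a : ι) :
    ((l ++ [a]).dropWhile f).length ≤ (l.dropWhile f).length + 1 := by
  induction l with
  | nil => simpa using List.length_dropWhile_le f [a]
  | cons b l ih => by_cases h : f b <;> simp_all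

theorem length_lt_length_dropWhile_append_cons {a : ι} (ha : ¬ f a) (l r : List ι) :
    r.length < ((l ++ a :: r).dropWhile f).length := by
  rw [List.dropWhile_append, List.dropWhile_cons_of_neg ha]
  split
  · simp
  · simp only [List.length_append, List.length_cons]
    omega

theorem eq_singleton_of_isPrefix {a b : ι} {l : List ι} (h : l <+: [a])
    (hl : l.getLast? = some b) : l = [a] := by
  rcases List.prefix_cons_iff.1 h with rfl | ⟨t, rfl, ht⟩
  · simp at hl
  · rw [List.prefix_nil.1 ht]

theorem finite_setOf_nodup (ι : Type*) [Finite ι] : {l : List ι | l.Nodup}.Finite := by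
  classical
  have := Fintype.ofFinite ι
  exact Set.finite_coe_iff.1 (inferInstanceAs (Finite {l : List ι // l.Nodup}))

end Lists

/-- The order compares two sets at the cheapest levels of `f` first, as a lexicographic order. -/
theorem wellFounded_exists_mem_notMem_forall_le {ι κ : Type*} [Finite ι] [LinearOrder κ]
    (f : ι → κ) :
    WellFounded fun X Y : Set ι => ∃ a ∈ X, a ∉ Y ∧ ∀ b ∈ Y, f b ≤ f a → b ∈ X := by
  have : Std.Irrefl fun X Y : Set ι => ∃ a ∈ X, a ∉ Y ∧ ∀ b ∈ Y, f b ≤ f a → b ∈ X :=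
    ⟨fun _ ⟨_, hX, hX', _⟩ => hX' hX⟩
  have : IsTrans (Set ι) fun X Y => ∃ a ∈ X, a ∉ Y ∧ ∀ b ∈ Y, f b ≤ f a → b ∈ X := by
    refine ⟨?_⟩
    rintro X Y Z ⟨a, haX, haY, ha⟩ ⟨b, hbY, hbZ, hb⟩
    rcases le_total (f b) (f a) with hba | hab
    · exact ⟨b, ha b hbY hba, hbZ, fun c hcZ hcb => ha c (hb c hcZ hcb) (hcb.trans hba)⟩
    · exact ⟨a, haX, fun haZ => haY (hb a haZ hab),
        fun c hcZ hca => ha c (hb c hcZ (hca.trans hab)) hca⟩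
  exact Finite.wellFounded_of_trans_of_irrefl _

namespace LazyProblem

variable {V : Type*} {P : LazyProblem V} {A B : Set (V × V)} {p q r : List V} {u v : V} {e : V × V}
  {α : ℕ∞} {β : ℕ}

theorem edges_concat (h : p.getLast? = some u) (v : V) :
    edges (p ++ [v]) = edges p ++ [(u, v)] := by
  induction p with
  | nil => simp at h
  | cons a p ih =>
    cases p with
    | nil => simp_all [edges]
    | cons b p =>
      have := ih (by simpa using h)
      simp_all [edges]

theorem edges_isPrefix (h : q <+: p) : edges q <+: edges p := by
  obtain ⟨t, rfl⟩ := h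
  induction t using List.reverseRecOn with
  | nil => simp
  | append_singleton t v ih =>
    rw [← List.append_assoc]
    rcases hu : (q ++ t).getLast? with _ | u
    · obtain ⟨rfl, -⟩ := List.append_eq_nil_iff.1 (List.getLast?_eq_none_iff.1 hu)
      simp [edges]
    · exact edges_concat hu v ▸ ih.trans (List.prefix_append _ _)

theorem mem_edges_of_concat_isPrefix (hu : q.getLast? = some u) (h : q ++ [v] <+: p) :
    (u, v) ∈ edges p :=
  (edges_isPrefix h).subset (by simp [edges_concat hu])

theorem exists_concat_isPrefix_of_edges_eq {l r : List (V × V)}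
    (h : edges p = l ++ (u, v) :: r) :
    ∃ q, q.getLast? = some u ∧ q ++ [v] <+: p ∧ edges q = l := by
  induction p using List.reverseRecOn generalizing r with
  | nil => simp [edges] at h
  | append_singleton p w ih =>
    rcases ha : p.getLast? with _ | a
    · simp [List.getLast?_eq_none_iff.1 ha, edges] at h
    rw [edges_concat ha] at h
    rcases List.eq_nil_or_concat r with rfl | ⟨r, x, rfl⟩
    · obtain ⟨hl, hx⟩ := List.append_inj' h rfl
      obtain ⟨rfl, rfl⟩ : a = u ∧ w = v := by simpa using hx
      exact ⟨p, ha, List.prefix_rfl, hl⟩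
    · have h' : edges p ++ [(a, w)] = (l ++ (u, v) :: r) ++ [x] := by simpa using h
      obtain ⟨q, hu, hqp, hl⟩ := ih (List.append_inj' h' rfl).1
      exact ⟨q, hu, hqp.trans (List.prefix_append _ _), hl⟩

/-- The lazy cost of the edges of a path. -/
noncomputable def cost (P : LazyProblem V) (p : List V) : ℝ≥0 := P.lazyCost (edges p)

@[simp]
theorem cost_singleton (a : V) : P.cost [a] = 0 := by simp [cost, edges, lazyCost]

theorem cost_concat (h : p.getLast? = some u) (v : V) :
    P.cost (p ++ [v]) = P.cost p + P.lazyWeight (u, v) := by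
  simp [cost, lazyCost, edges_concat h]

theorem cost_le_of_isPrefix (h : q <+: p) : P.cost q ≤ P.cost p :=
  ((edges_isPrefix h).sublist.map _).sum_le_sum fun _ _ => bot_le

theorem trueCost_eq_lazyCost {l : List (V × V)} (h : ∀ e ∈ l, P.CollisionFree e) :
    P.trueCost l = (P.lazyCost l : ℝ≥0∞) := by
  induction l with
  | nil => simp [trueCost, lazyCost]
  | cons a l ih => simp_all [trueCost, lazyCost, CollisionFree]

theorem headEdges_append_tailEdges (A : Set (V × V)) (p : List V) :
    headEdges A p ++ tailEdges A p = edges p := List.takeWhile_append_dropWhile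

theorem mem_of_mem_headEdges (h : e ∈ headEdges A p) : e ∈ A := by
  simpa using List.mem_takeWhile_imp h

theorem budget_eq_zero_iff : budget A p = 0 ↔ ∀ e ∈ edges p, e ∈ A := by
  simp [budget, tailEdges, List.dropWhile_eq_nil_iff]

theorem budget_anti (h : A ⊆ B) (p : List V) : budget B p ≤ budget A p :=
  length_dropWhile_le_of_imp (fun x hx => by simpa using h (by simpa using hx)) _

theorem budget_concat_le (h : p.getLast? = some u) (v : V) :
    budget A (p ++ [v]) ≤ budget A p + 1 := by
  simpa [budget, tailEdges, edges_concat h] using length_dropWhile_concat_le _ _ _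

theorem length_edges_le_of_notMem (hu : q.getLast? = some u) (h : q ++ [v] <+: p)
    (huv : (u, v) ∉ A) : (edges p).length ≤ (edges q).length + budget A p := by
  obtain ⟨r, hr⟩ := edges_isPrefix h
  rw [edges_concat hu, List.append_assoc, List.singleton_append] at hr
  classical
  have : r.length < budget A p := by
    rw [budget, tailEdges, ← hr]
    exact length_lt_length_dropWhile_append_cons (by simpa using huv) _ _
  rw [← hr, List.length_append, List.length_cons]
  omega

theorem notMem_of_tailEdges_eq_cons {l : List (V × V)} (h : tailEdges A p = e :: l) : e ∉ A := by
  have := List.head?_dropWhile_not (fun e => @decide (e ∈ A) (Classical.propDecidable _)) (edges p)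
  rw [← tailEdges, h] at this
  simpa using this

theorem mem_edges_of_mem_evaluatedOn (h : e ∈ P.evaluatedOn β A p) : e ∈ edges p := by
  obtain ⟨l₁, l₂, htake, -⟩ := h
  rw [← headEdges_append_tailEdges A p]
  have : e ∈ (tailEdges A p).take β := by simp [htake]
  exact List.mem_append_right _ (List.mem_of_mem_take this)

theorem exists_mem_evaluatedOn_notMem (P : LazyProblem V) (hβ : 1 ≤ β) (h : budget A p ≠ 0) :
    ∃ e ∈ P.evaluatedOn β A p, e ∉ A := by
  obtain ⟨e, l, hl⟩ := List.exists_cons_of_length_pos (Nat.pos_of_ne_zero h)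
  obtain ⟨n, rfl⟩ := Nat.exists_eq_add_of_le' hβ
  exact ⟨e, ⟨[], l.take n, by simp [hl], by simp⟩, notMem_of_tailEdges_eq_cons hl⟩

/-- `p` is a walk from the source to `u` whose edges are not removed and which does not pass
through the target before its end: the nodes of the search tree are such walks. -/
inductive IsWalk (P : LazyProblem V) (A : Set (V × V)) : List V → V → Prop
  | source : IsWalk P A [P.source] P.source
  | snoc {p : List V} {u v : V} : IsWalk P A p u → u ≠ P.target → P.graph.Adj u v →
      ¬ P.Removed A (u, v) → IsWalk P A (p ++ [v]) v

namespace IsWalk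

theorem getLast? (h : P.IsWalk A p u) : p.getLast? = some u := by
  cases h <;> simp

theorem eq_singleton_or_exists_edge (h : P.IsWalk A p u) :
    p = [P.source] ∨ ∃ a, (a, u) ∈ edges p := by
  cases h with
  | source => exact Or.inl rfl
  | snoc hq => exact Or.inr ⟨_, mem_edges_of_concat_isPrefix hq.getLast? List.prefix_rfl⟩

theorem head? (h : P.IsWalk A p u) : p.head? = some P.source := by
  induction h with
  | source => rfl
  | snoc _ _ _ _ ih => simp [List.head?_append, ih]

theorem isChain (h : P.IsWalk A p u) : p.IsChain P.graph.Adj := by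
  induction h with
  | source => simp
  | snoc hp _ hadj _ ih =>
    refine List.isChain_append.2 ⟨ih, by simp, ?_⟩
    simpa [hp.getLast?] using hadj

theorem isSimplePathFromSource (h : P.IsWalk A p u) (hp : p.Nodup) :
    P.IsSimplePathFromSource p :=
  ⟨h.head?, h.isChain, hp⟩

theorem not_removed (h : P.IsWalk A p u) : ∀ e ∈ edges p, ¬ P.Removed A e := by
  induction h with
  | source => simp [edges]
  | snoc hp _ _ hr ih =>
    rw [edges_concat hp.getLast?]
    exact List.forall_mem_append.2 ⟨ih, by simpa using hr⟩

theorem collisionFree (h : P.IsWalk A p u) (he : e ∈ edges p) (heA : e ∈ A) :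
    P.CollisionFree e :=
  not_not.1 fun hc => h.not_removed e he ⟨heA, hc⟩

theorem transfer (h : P.IsWalk A p u) (hB : ∀ e ∈ edges p, ¬ P.Removed B e) :
    P.IsWalk B p u := by
  induction h with
  | source => exact .source
  | snoc hp ht hadj _ ih =>
    rw [edges_concat hp.getLast?] at hB
    exact .snoc (ih fun e he => hB e (by simp [he])) ht hadj (hB _ (by simp))

theorem anti (h : P.IsWalk B p u) (hAB : A ⊆ B) : P.IsWalk A p u :=
  h.transfer fun e he hr => h.not_removed e he ⟨hAB hr.1, hr.2⟩

theorem of_isPrefix (h : P.IsWalk A p u) (hqp : q <+: p) (hv : q.getLast? = some v) :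
    P.IsWalk A q v := by
  induction h with
  | source =>
    obtain rfl := eq_singleton_of_isPrefix hqp hv
    obtain rfl : P.source = v := by simpa using hv
    exact .source
  | snoc hp ht hadj hr ih =>
    rcases List.prefix_concat_iff.1 hqp with rfl | hq
    · obtain rfl : _ = v := by simpa using hv
      exact .snoc hp ht hadj hr
    · exact ih hq

theorem eq_of_isPrefix_target (h : P.IsWalk A p u) (hqp : q <+: p)
    (hq : q.getLast? = some P.target) : q = p := by
  induction h with
  | source => exact eq_singleton_of_isPrefix hqp hq
  | snoc hp ht _ _ ih =>
    rcases List.prefix_concat_iff.1 hqp with rfl | hq'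
    · rfl
    · rw [ih hq', hp.getLast?] at hq
      exact absurd (Option.some_injective _ hq) ht

theorem key_eq (h : P.IsWalk A p u) : P.key A p = (P.cost p : ℝ≥0∞) := by
  have hhead := trueCost_eq_lazyCost (P := P) (l := headEdges A p) fun e he =>
    h.collisionFree (headEdges_append_tailEdges A p ▸ List.mem_append_left _ he)
      (mem_of_mem_headEdges he)
  rw [key, hhead, cost, ← headEdges_append_tailEdges A p]
  simp [lazyCost]

end IsWalk

/-- `p` is a cheapest walk from the source to `u`. -/
structure IsGeodesic (P : LazyProblem V) (A : Set (V × V)) (p : List V) (u : V) : Prop where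
  isWalk : P.IsWalk A p u
  cost_le : ∀ q, P.IsWalk A q u → P.cost p ≤ P.cost q

namespace IsGeodesic

theorem source : P.IsGeodesic A [P.source] P.source :=
  ⟨.source, fun _ _ => by simp⟩

theorem of_isPrefix (h : P.IsGeodesic A p u) (hqp : q <+: p) (hv : q.getLast? = some v) :
    P.IsGeodesic A q v := by
  obtain ⟨hp, hle⟩ := h
  refine ⟨hp.of_isPrefix hqp hv, ?_⟩
  induction hp with
  | source =>
    simp [eq_singleton_of_isPrefix hqp hv]
  | snoc hp ht hadj hr ih =>
    rcases List.prefix_concat_iff.1 hqp with rfl | hq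
    · obtain rfl : _ = v := by simpa using hv
      exact hle
    · refine ih hq fun r hru => ?_
      simpa [cost_concat hp.getLast?, cost_concat hru.getLast?] using
        hle _ (hru.snoc ht hadj hr)

theorem of_concat (h : P.IsGeodesic A (p ++ [v]) v) (hu : p.getLast? = some u) :
    P.IsGeodesic A p u :=
  h.of_isPrefix (List.prefix_append _ _) hu

theorem nodup (h : P.IsGeodesic A p u) : p.Nodup := by
  induction h.isWalk with
  | source => simp
  | @snoc p u v hp _ hadj _ ih =>
    have hv : v ∉ p := fun hv => by
      obtain ⟨s, t, rfl⟩ := List.append_of_mem hv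
      have hs : s ++ [v] <+: s ++ v :: t := ⟨t, by simp⟩
      have hle := (h.cost_le _ (hp.of_isPrefix hs (by simp))).trans (cost_le_of_isPrefix hs)
      rw [cost_concat hp.getLast?] at hle
      exact hle.not_gt (lt_add_of_pos_right _ (P.lazyWeight_pos u v hadj))
    simpa using (ih (h.of_concat hp.getLast?)).concat hv

theorem isSimplePathFromSource (h : P.IsGeodesic A p u) : P.IsSimplePathFromSource p :=
  h.isWalk.isSimplePathFromSource h.nodup

theorem unique (hP : P.DistinctPathWeights) (hp : P.IsGeodesic A p u) (hq : P.IsGeodesic A q u) :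
    p = q :=
  hP p q hp.isSimplePathFromSource hq.isSimplePathFromSource
    ((hp.cost_le q hq.isWalk).antisymm (hq.cost_le p hp.isWalk))

theorem mono (h : P.IsGeodesic A p u) (hAB : A ⊆ B) (hB : ∀ e ∈ edges p, ¬ P.Removed B e) :
    P.IsGeodesic B p u :=
  ⟨h.isWalk.transfer hB, fun q hq => h.cost_le q (hq.anti hAB)⟩

theorem anti (h : P.IsGeodesic B p u) (hAB : A ⊆ B)
    (hr : ∀ e, P.Removed B e → P.Removed A e) : P.IsGeodesic A p u :=
  ⟨h.isWalk.anti hAB,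
    fun q hq => h.cost_le q (hq.transfer fun e he heB => hq.not_removed e he (hr e heB))⟩

end IsGeodesic

/-- A vertex is settled if a geodesic to it is completely evaluated, as in Dijkstra's algorithm. -/
def IsSettled (P : LazyProblem V) (A : Set (V × V)) (u : V) : Prop :=
  ∃ q, P.IsGeodesic A q u ∧ ∀ e ∈ edges q, e ∈ A

theorem IsGeodesic.isSettled (h : P.IsGeodesic A p u) (hAB : A ⊆ B)
    (hp : ∀ e ∈ edges p, P.CollisionFree e ∧ e ∈ B) : P.IsSettled B u :=
  ⟨p, h.mono hAB fun e he hr => hr.2 (hp e he).1, fun e he => (hp e he).2⟩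

theorem IsSettled.mono (h : P.IsSettled A u) (hAB : A ⊆ B) : P.IsSettled B u := by
  obtain ⟨q, hq, hqA⟩ := h
  exact hq.isSettled hAB fun e he => ⟨hq.isWalk.collisionFree he (hqA e he), hAB (hqA e he)⟩

/-- The evaluated edges start at settled vertices, and also end there if they are collision free:
an invariant of the algorithm. -/
def EvaluatedSettled (P : LazyProblem V) (A : Set (V × V)) : Prop :=
  ∀ u v, (u, v) ∈ A → P.IsSettled A u ∧ (P.CollisionFree (u, v) → P.IsSettled A v)

theorem IsGeodesic.not_removed_or_exists_first (hP : P.DistinctPathWeights) (hAB : A ⊆ B)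
    (hB : P.EvaluatedSettled B) (hp : P.IsGeodesic A p u) :
    (∀ e ∈ edges p, ¬ P.Removed B e) ∨ ∃ q a b, q.getLast? = some a ∧ q ++ [b] <+: p ∧
      P.Removed B (a, b) ∧ ∀ e ∈ edges q, e ∈ B := by
  induction hp.isWalk with
  | source => simp [edges]
  | @snoc p u v hpu _ _ _ ih =>
    have hu := hpu.getLast?
    rcases ih (hp.of_concat hu) with h | ⟨q, a, b, ha, hqp, hab, hqB⟩
    · by_cases huv : P.Removed B (u, v)
      · obtain ⟨q, hq, hqB⟩ := (hB u v huv.1).1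
        obtain rfl := ((hp.of_concat hu).mono hAB h).unique hP hq
        exact Or.inr ⟨p, u, v, hu, List.prefix_rfl, huv, hqB⟩
      · refine Or.inl ?_
        rw [edges_concat hu]
        exact List.forall_mem_append.2 ⟨h, by simpa using huv⟩
    · exact Or.inr ⟨q, a, b, ha, hqp.trans (List.prefix_append _ _), hab, hqB⟩

theorem IsGeodesic.not_removed_of_notMem (hP : P.DistinctPathWeights) (hAB : A ⊆ B)
    (hB : P.EvaluatedSettled B) {w : V} (hp : P.IsGeodesic A p w) (hu : q.getLast? = some u)
    (hqp : q ++ [v] <+: p) (hq : ∀ e ∈ edges q, P.CollisionFree e) (huv : (u, v) ∉ B) :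
    ∀ e ∈ edges p, ¬ P.Removed B e := by
  refine (hp.not_removed_or_exists_first hP hAB hB).resolve_right ?_
  rintro ⟨r, a, b, ha, hrp, hab, hrB⟩
  rcases List.prefix_or_prefix_of_prefix hrp hqp with h | h
  · have := mem_edges_of_concat_isPrefix ha h
    rw [edges_concat hu, List.mem_append, List.mem_singleton] at this
    rcases this with hmem | heq
    exacts [hab.2 (hq _ hmem), huv (heq ▸ hab.1)]
  · have := mem_edges_of_concat_isPrefix hu h
    rw [edges_concat ha, List.mem_append, List.mem_singleton] at this
    rcases this with hmem | heq
    exacts [huv (hrB _ hmem), huv (heq ▸ hab.1)]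

theorem IsWalk.exists_isPrefix_of_mem_evaluatedOn {w : V} (hw : P.IsWalk A p w)
    (h : (u, v) ∈ P.evaluatedOn β A p) :
    ∃ q, q.getLast? = some u ∧ q ++ [v] <+: p ∧
      (edges q).length + budget A p < (edges p).length + β ∧
      ∀ e ∈ edges q, P.CollisionFree e ∧ e ∈ A ∪ P.evaluatedOn β A p := by
  obtain ⟨l₁, l₂, htake, hfree⟩ := h
  have htail : tailEdges A p = l₁ ++ (u, v) :: (l₂ ++ (tailEdges A p).drop β) := by
    rw [← List.cons_append, ← List.append_assoc, ← htake, List.take_append_drop]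
  have hedges : edges p = (headEdges A p ++ l₁) ++ (u, v) :: (l₂ ++ (tailEdges A p).drop β) := by
    rw [List.append_assoc, ← htail, headEdges_append_tailEdges]
  have hlen : l₁.length < β := by
    have := congrArg List.length htake
    simp only [List.length_take, List.length_append, List.length_cons] at this
    omega
  obtain ⟨q, hu, hqp, hq⟩ := exists_concat_isPrefix_of_edges_eq hedges
  refine ⟨q, hu, hqp, ?_, fun e he => ?_⟩
  · rw [hq, ← headEdges_append_tailEdges A p, budget, List.length_append, List.length_append]
    omega
  · rcases List.mem_append.1 (hq ▸ he) with hhead | hl₁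
    · have heA := mem_of_mem_headEdges hhead
      exact ⟨hw.collisionFree (by simp [hedges, hhead]) heA, Or.inl heA⟩
    · obtain ⟨a, b, rfl⟩ := List.append_of_mem hl₁
      exact ⟨hfree e hl₁, Or.inr
        ⟨a, b ++ (u, v) :: l₂, by simp [htake], fun x hx => hfree x (by simp [hx])⟩⟩

section SearchTree

variable {T T' : Set (List V)}

/-- `T` is a possible search tree: its nodes are simple walks with budget at most `α`, with one node
for each vertex, and it contains the ancestors of its nodes, which are their nonempty initial
parts. -/
structure IsSearchTree (P : LazyProblem V) (α : ℕ∞) (A : Set (V × V)) (T : Set (List V)) :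
    Prop where
  source_mem : [P.source] ∈ T
  exists_isWalk : ∀ p ∈ T, ∃ u, P.IsWalk A p u
  nodup : ∀ p ∈ T, p.Nodup
  mem_of_isPrefix : ∀ p ∈ T, ∀ q, q <+: p → q ≠ [] → q ∈ T
  budget_le : ∀ p ∈ T, (budget A p : ℕ∞) ≤ α
  unique : ∀ p ∈ T, ∀ q ∈ T, p.getLast? = q.getLast? → p = q

namespace IsSearchTree

theorem isWalk (hT : P.IsSearchTree α A T) (hp : p ∈ T) (hu : p.getLast? = some u) :
    P.IsWalk A p u := by
  obtain ⟨v, hv⟩ := hT.exists_isWalk p hp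
  obtain rfl : v = u := by simpa [hv.getLast?] using hu
  exact hv

theorem singleton (P : LazyProblem V) (α : ℕ∞) (A : Set (V × V)) :
    P.IsSearchTree α A {[P.source]} where
  source_mem := rfl
  exists_isWalk := by
    rintro _ rfl
    exact ⟨_, .source⟩
  nodup := by simp
  mem_of_isPrefix := by
    rintro _ rfl q hq hne
    exact eq_singleton_of_isPrefix hq (List.getLast?_eq_some_getLast hne)
  budget_le := by simp [budget, tailEdges, edges]
  unique := by simp

theorem cost_lt_of_mem (hT : P.IsSearchTree α A T) (hp : P.IsWalk A p v)
    (hlt : ∀ q ∈ T, q.getLast? = some v → P.key A p < P.key A q) (hq : q ∈ T) (hv : v ∈ q) :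
    P.cost p < P.cost q := by
  obtain ⟨s, t, rfl⟩ := List.append_of_mem hv
  have hs : s ++ [v] <+: s ++ v :: t := ⟨t, by simp⟩
  have hsT := hT.mem_of_isPrefix _ hq _ hs (by simp)
  have := hlt _ hsT (by simp)
  rw [hp.key_eq, (hT.isWalk (u := v) hsT (by simp)).key_eq, ENNReal.coe_lt_coe] at this
  exact this.trans_le (cost_le_of_isPrefix hs)

theorem relax (hT : P.IsSearchTree α A T) (h : P.Relax α A T T') : P.IsSearchTree α A T' := by
  obtain ⟨p, u, v, hp, hu, ht, hb, hadj, hr, hlt, rfl⟩ := h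
  have hpv := IsWalk.snoc (hT.isWalk hp hu) ht hadj hr
  have hcost : ∀ q ∈ T, v ∈ q → P.cost (p ++ [v]) < P.cost q :=
    fun q hq => hT.cost_lt_of_mem hpv hlt hq
  have hvp : v ∉ p := fun hv => (cost_le_of_isPrefix (List.prefix_append p [v])).not_gt
    (hcost p hp hv)
  refine ⟨Or.inr ⟨hT.source_mem, fun h => ?_⟩, ?_, ?_, ?_, ?_, ?_⟩
  · simpa using hcost _ hT.source_mem h
  · rintro q (rfl | ⟨hq, -⟩)
    exacts [⟨v, hpv⟩, hT.exists_isWalk q hq]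
  · rintro q (rfl | ⟨hq, -⟩)
    exacts [by simpa using (hT.nodup p hp).concat hvp, hT.nodup q hq]
  · rintro q (rfl | ⟨hq, hvq⟩) r hrq hne
    · rcases List.prefix_concat_iff.1 hrq with rfl | hrp
      exacts [Or.inl rfl, Or.inr ⟨hT.mem_of_isPrefix p hp r hrp hne, fun h => hvp (hrp.subset h)⟩]
    · exact Or.inr ⟨hT.mem_of_isPrefix q hq r hrq hne, fun h => hvq (hrq.subset h)⟩
  · rintro q (rfl | ⟨hq, -⟩)
    · exact (by exact_mod_cast budget_concat_le hu v :
        (budget A (p ++ [v]) : ℕ∞) ≤ budget A p + 1).trans (Order.add_one_le_of_lt hb)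
    · exact hT.budget_le q hq
  · rintro q (rfl | ⟨hq, hvq⟩) r (rfl | ⟨hr, hvr⟩) h
    · rfl
    · exact absurd (List.mem_of_getLast? (h.symm.trans (by simp))) hvr
    · exact absurd (List.mem_of_getLast? (h.trans (by simp))) hvq
    · exact hT.unique q hq r hr h

theorem exists_new_of_relax (hT : P.IsSearchTree α A T) (h : P.Relax α A T T') :
    ∃ p ∈ T', p ∉ T ∧ ∀ q ∈ T, P.cost q ≤ P.cost p → q ∈ T' := by
  obtain ⟨p, u, v, hp, hu, ht, -, hadj, hr, hlt, rfl⟩ := h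
  have hpv := IsWalk.snoc (hT.isWalk hp hu) ht hadj hr
  exact ⟨p ++ [v], Or.inl rfl, fun hmem => (hlt _ hmem hpv.getLast?).false,
    fun q hq hqp => Or.inr ⟨hq, fun hv => hqp.not_gt (hT.cost_lt_of_mem hpv hlt hq hv)⟩⟩

theorem of_reflTransGen (hT : P.IsSearchTree α A T)
    (h : Relation.ReflTransGen (P.Relax α A) T T') : P.IsSearchTree α A T' := by
  induction h with
  | refl => exact hT
  | tail _ h ih => exact ih.relax h

theorem prune (hT : P.IsSearchTree α A T) (hAB : A ⊆ B) :
    P.IsSearchTree α B (P.prune B T) where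
  source_mem := ⟨hT.source_mem, by simp [edges]⟩
  exists_isWalk p hp := (hT.exists_isWalk p hp.1).imp fun _ hu => hu.transfer hp.2
  nodup p hp := hT.nodup p hp.1
  mem_of_isPrefix p hp q hqp hne :=
    ⟨hT.mem_of_isPrefix p hp.1 q hqp hne, fun e he => hp.2 e ((edges_isPrefix hqp).subset he)⟩
  budget_le p hp := (Nat.cast_le.2 (budget_anti hAB p)).trans (hT.budget_le p hp.1)
  unique p hp q hq := hT.unique p hp.1 q hq.1

theorem finite [Finite V] (hT : P.IsSearchTree α A T) : T.Finite :=
  (finite_setOf_nodup V).subset hT.nodup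

theorem exists_extends [Finite V] (hT : P.IsSearchTree α A T) : ∃ T', P.Extends α A T T' := by
  have : Finite {l : List V // l.Nodup} := (finite_setOf_nodup V).to_subtype
  have wf := wellFounded_exists_mem_notMem_forall_le fun l : {l : List V // l.Nodup} => P.cost l.1
  induction hX : {l : {l : List V // l.Nodup} | l.1 ∈ T} using wf.induction generalizing T with
  | _ X ih =>
    subst hX
    by_cases h : ∃ T₁, P.Relax α A T T₁
    · obtain ⟨T₁, h₁⟩ := h
      have hT₁ := hT.relax h₁
      obtain ⟨p, hp, hpT, hle⟩ := hT.exists_new_of_relax h₁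
      obtain ⟨T', h', hmax⟩ := ih {l | l.1 ∈ T₁}
        ⟨⟨p, hT₁.nodup p hp⟩, hp, hpT, fun q hq => hle q.1 hq⟩ hT₁ rfl
      exact ⟨T', .head h₁ h', hmax⟩
    · exact ⟨T, .refl, not_exists.1 h⟩

end IsSearchTree

end SearchTree

section States

variable {S S' : State V}

/-- The tree of `S` is a search tree that admits no further elementary operation: a property of the
states between two iterations. -/
structure IsComplete (P : LazyProblem V) (α : ℕ∞) (S : State V) : Prop where
  isSearchTree : P.IsSearchTree α S.evaluated S.tree
  not_relax : ∀ T, ¬ P.Relax α S.evaluated S.tree T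

/-- `p` is a frontier node of minimal key, which the algorithm may choose in state `S`. -/
def IsChosen (P : LazyProblem V) (α : ℕ∞) (S : State V) (p : List V) : Prop :=
  P.IsFrontier α S p ∧ ∀ q, P.IsFrontier α S q → P.key S.evaluated p ≤ P.key S.evaluated q

theorem Iteration.exists_isChosen (h : P.Iteration α β S S') :
    ∃ p, P.IsChosen α S p ∧ S'.evaluated = S.evaluated ∪ P.evaluatedOn β S.evaluated p :=
  let ⟨_, p, hp, hmin, hS', _⟩ := h
  ⟨p, ⟨hp, hmin⟩, hS'⟩

theorem Iteration.evaluated_subset (h : P.Iteration α β S S') : S.evaluated ⊆ S'.evaluated := by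
  obtain ⟨p, -, hS'⟩ := h.exists_isChosen
  exact hS' ▸ Set.subset_union_left

theorem IsInitial.isComplete (h : P.IsInitial α S) : P.IsComplete α S := by
  obtain ⟨hA, hT, hmax⟩ := h
  exact ⟨hA ▸ (IsSearchTree.singleton P α ∅).of_reflTransGen hT, hA ▸ hmax⟩

namespace IsComplete

theorem iteration (hS : P.IsComplete α S) (h : P.Iteration α β S S') : P.IsComplete α S' := by
  obtain ⟨-, p, -, -, -, hT, hmax⟩ := id h
  exact ⟨(hS.isSearchTree.prune h.evaluated_subset).of_reflTransGen hT, hmax⟩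

theorem isWalk (hS : P.IsComplete α S) (hp : p ∈ S.tree) (hu : p.getLast? = some u) :
    P.IsWalk S.evaluated p u :=
  hS.isSearchTree.isWalk hp hu

theorem eq_of_getLast? (hS : P.IsComplete α S) (hp : p ∈ S.tree) (hq : q ∈ S.tree)
    (hpu : p.getLast? = some u) (hqu : q.getLast? = some u) : p = q :=
  hS.isSearchTree.unique p hp q hq (hpu.trans hqu.symm)

theorem exists_node_of_adj (hS : P.IsComplete α S) (hp : p ∈ S.tree) (hu : p.getLast? = some u)
    (ht : u ≠ P.target) (hb : (budget S.evaluated p : ℕ∞) < α) (hadj : P.graph.Adj u v)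
    (hr : ¬ P.Removed S.evaluated (u, v)) :
    ∃ q ∈ S.tree, q.getLast? = some v ∧ P.cost q ≤ P.cost (p ++ [v]) := by
  by_contra! h
  refine hS.not_relax _ ⟨p, u, v, hp, hu, ht, hb, hadj, hr, fun q hq hv => ?_, rfl⟩
  rw [(hS.isWalk hq hv).key_eq, ((hS.isWalk hp hu).snoc ht hadj hr).key_eq, ENNReal.coe_lt_coe]
  exact h q hq hv

theorem exists_node_of_isWalk (hS : P.IsComplete α S) (hp : P.IsWalk S.evaluated p u) :
    ∃ q ∈ S.tree, P.cost q ≤ P.cost p ∧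
      (q.getLast? = some u ∨ (budget S.evaluated q : ℕ∞) = α) := by
  induction hp with
  | source => exact ⟨_, hS.isSearchTree.source_mem, le_rfl, Or.inl rfl⟩
  | @snoc p u v hp ht hadj hr ih =>
    have hle : P.cost p ≤ P.cost (p ++ [v]) := cost_le_of_isPrefix (List.prefix_append _ _)
    obtain ⟨q, hq, hqp, hu⟩ := ih
    rcases (hS.isSearchTree.budget_le q hq).lt_or_eq with hb | hb
    · have hu := hu.resolve_right hb.ne
      obtain ⟨r, hr, hv, hrq⟩ := hS.exists_node_of_adj hq hu ht hb hadj hr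
      refine ⟨r, hr, hrq.trans ?_, Or.inl hv⟩
      rw [cost_concat hu, cost_concat hp.getLast?]
      gcongr
    · exact ⟨q, hq, hqp.trans hle, Or.inr hb⟩

theorem exists_isPrefix_mem (hS : P.IsComplete α S) (hP : P.DistinctPathWeights)
    (hp : P.IsGeodesic S.evaluated p u) :
    ∃ q ∈ S.tree, q <+: p ∧ (q = p ∨ (budget S.evaluated q : ℕ∞) = α) := by
  induction hp.isWalk with
  | source => exact ⟨_, hS.isSearchTree.source_mem, List.prefix_rfl, Or.inl rfl⟩
  | @snoc p u v hpu ht hadj hr ih =>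
    obtain ⟨q, hq, hqp, hor⟩ := ih (hp.of_concat hpu.getLast?)
    by_cases hb : (budget S.evaluated q : ℕ∞) = α
    · exact ⟨q, hq, hqp.trans (List.prefix_append _ _), Or.inr hb⟩
    obtain rfl := hor.resolve_right hb
    obtain ⟨r, hrT, hv, hrq⟩ := hS.exists_node_of_adj hq hpu.getLast? ht
      ((hS.isSearchTree.budget_le q hq).lt_of_ne hb) hadj hr
    have hrw := hS.isWalk hrT hv
    have hrp : r = q ++ [v] := hP _ _ (hrw.isSimplePathFromSource (hS.isSearchTree.nodup r hrT))
      hp.isSimplePathFromSource (hrq.antisymm (hp.cost_le r hrw))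
    exact ⟨r, hrT, hrp ▸ List.prefix_rfl, Or.inl hrp⟩

theorem mem_of_evaluated (hS : P.IsComplete α S) (hP : P.DistinctPathWeights) (hα : α ≠ 0)
    (hp : P.IsGeodesic S.evaluated p u) (he : ∀ e ∈ edges p, e ∈ S.evaluated) : p ∈ S.tree := by
  obtain ⟨q, hq, hqp, rfl | hb⟩ := hS.exists_isPrefix_mem hP hp
  · exact hq
  · rw [budget_eq_zero_iff.2 fun e h => he e ((edges_isPrefix hqp).subset h)] at hb
    exact absurd hb.symm (by simpa using hα)

theorem exists_isFrontier_isPrefix (hS : P.IsComplete α S) (hP : P.DistinctPathWeights)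
    (hp : P.IsGeodesic S.evaluated p u) (h : α ≤ budget S.evaluated p ∨ u = P.target) :
    ∃ q, P.IsFrontier α S q ∧ q <+: p := by
  obtain ⟨q, hq, hqp, rfl | hb⟩ := hS.exists_isPrefix_mem hP hp
  · refine ⟨q, ⟨hq, h.imp (fun hb => (hS.isSearchTree.budget_le q hq).antisymm hb) ?_⟩, hqp⟩
    rintro rfl
    exact hp.isWalk.getLast?
  · exact ⟨q, ⟨hq, Or.inl hb⟩, hqp⟩

theorem cost_le_of_isChosen (hS : P.IsComplete α S) (hp : P.IsChosen α S p)
    (hq : P.IsFrontier α S q) : P.cost p ≤ P.cost q := by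
  obtain ⟨u, hu⟩ := hS.isSearchTree.exists_isWalk p hp.1.1
  obtain ⟨v, hv⟩ := hS.isSearchTree.exists_isWalk q hq.1
  have := hp.2 q hq
  rwa [hu.key_eq, hv.key_eq, ENNReal.coe_le_coe] at this

theorem isGeodesic_of_isChosen (hS : P.IsComplete α S) (hp : P.IsChosen α S p)
    (hu : p.getLast? = some u) : P.IsGeodesic S.evaluated p u := by
  refine ⟨hS.isWalk hp.1.1 hu, fun r hr => ?_⟩
  obtain ⟨q, hq, hqr, hqu | hb⟩ := hS.exists_node_of_isWalk hr
  · rwa [hS.eq_of_getLast? hp.1.1 hq hu hqu]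
  · exact (hS.cost_le_of_isChosen hp ⟨hq, Or.inl hb⟩).trans hqr

theorem cost_le_of_isWalk_target (hS : P.IsComplete α S) (hp : P.IsChosen α S p)
    (hr : P.IsWalk S.evaluated r P.target) : P.cost p ≤ P.cost r := by
  obtain ⟨q, hq, hqr, h⟩ := hS.exists_node_of_isWalk hr
  exact (hS.cost_le_of_isChosen hp ⟨hq, h.symm⟩).trans hqr

theorem isGeodesic_of_budget_eq_zero (hS : P.IsComplete α S) (hP : P.DistinctPathWeights)
    (hα : α ≠ 0) (hA : P.EvaluatedSettled S.evaluated) (hp : p ∈ S.tree)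
    (hu : p.getLast? = some u) (hb : budget S.evaluated p = 0) :
    P.IsGeodesic S.evaluated p u := by
  rw [budget_eq_zero_iff] at hb
  have hw := hS.isWalk hp hu
  rcases hw.eq_singleton_or_exists_edge with rfl | ⟨a, ha⟩
  · obtain rfl : P.source = u := by simpa using hu
    exact .source
  · obtain ⟨r, hr, hrA⟩ := (hA a u (hb _ ha)).2 (hw.collisionFree ha (hb _ ha))
    rwa [hS.eq_of_getLast? hp (hS.mem_of_evaluated hP hα hr hrA) hu hr.isWalk.getLast?]

end IsComplete

theorem EvaluatedSettled.iteration (hA : P.EvaluatedSettled S.evaluated)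
    (hS : P.IsComplete α S) (h : P.Iteration α β S S') : P.EvaluatedSettled S'.evaluated := by
  intro u v huv
  have hsub := h.evaluated_subset
  obtain ⟨p, hp, hS'⟩ := h.exists_isChosen
  rcases hS' ▸ huv with hold | hnew
  · exact ⟨(hA u v hold).1.mono hsub, fun hc => ((hA u v hold).2 hc).mono hsub⟩
  · obtain ⟨w, hw⟩ := hS.isSearchTree.exists_isWalk p hp.1.1
    have hg := hS.isGeodesic_of_isChosen hp hw.getLast?
    obtain ⟨q, hu, hqp, -, hq⟩ := hw.exists_isPrefix_of_mem_evaluatedOn hnew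
    rw [← hS'] at hq
    have hgv := hg.of_isPrefix (v := v) hqp (by simp)
    refine ⟨(hgv.of_concat hu).isSettled hsub hq, fun hc => hgv.isSettled hsub ?_⟩
    rw [edges_concat hu]
    exact List.forall_mem_append.2 ⟨hq, by simpa using ⟨hc, huv⟩⟩

theorem Iteration.isChosen_of_budget_eq_zero (h : P.Iteration α β S S')
    (hP : P.DistinctPathWeights) (hα : α ≠ 0) (hS : P.IsComplete α S)
    (hA : P.EvaluatedSettled S.evaluated) (hr : r ∈ S'.tree)
    (ht : r.getLast? = some P.target) (hb : budget S'.evaluated r = 0) :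
    P.IsChosen α S r ∧ S'.evaluated = S.evaluated ∪ P.evaluatedOn β S.evaluated r := by
  have hnot := h.1
  obtain ⟨p, hp, hS'⟩ := h.exists_isChosen
  suffices r = p from this ▸ ⟨hp, hS'⟩
  have hw := (hS.iteration h).isWalk hr ht
  rw [budget_eq_zero_iff] at hb
  rcases hw.eq_singleton_or_exists_edge with rfl | ⟨a, ha⟩
  · exact absurd ⟨_, hS.isSearchTree.source_mem, ht, by simp [budget, tailEdges, edges]⟩ hnot
  have hfree := hw.collisionFree ha (hb _ ha)
  rcases hS' ▸ hb _ ha with hold | hnew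
  · obtain ⟨q, hq, hqA⟩ := (hA a P.target hold).2 hfree
    exact absurd ⟨q, hS.mem_of_evaluated hP hα hq hqA, hq.isWalk.getLast?,
      budget_eq_zero_iff.2 hqA⟩ hnot
  · obtain ⟨w, hpw⟩ := hS.isSearchTree.exists_isWalk p hp.1.1
    obtain ⟨q, hq, hqp, -, hqA⟩ := hpw.exists_isPrefix_of_mem_evaluatedOn hnew
    obtain rfl := hpw.eq_of_isPrefix_target hqp (by simp)
    rw [← hS'] at hqA
    have hqt : ∀ e ∈ edges (q ++ [P.target]), P.CollisionFree e ∧ e ∈ S'.evaluated := by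
      rw [edges_concat hq]
      exact List.forall_mem_append.2 ⟨hqA, by simpa using ⟨hfree, hb _ ha⟩⟩
    have hg := (hS.isGeodesic_of_isChosen (u := P.target) hp (by simp)).mono h.evaluated_subset
      fun e he hrem => hrem.2 (hqt e he).1
    exact (hS.iteration h).eq_of_getLast? hr ((hS.iteration h).mem_of_evaluated hP hα hg
      fun e he => (hqt e he).2) ht (by simp)

/-- `S` occurs in a run of the algorithm with lookahead `α` and greediness `β`. -/
def Reachable (P : LazyProblem V) (α : ℕ∞) (β : ℕ) (S : State V) : Prop :=
  ∃ S₀, P.IsInitial α S₀ ∧ Relation.ReflTransGen (P.Iteration α β) S₀ S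

namespace Reachable

theorem isComplete (h : P.Reachable α β S) : P.IsComplete α S := by
  obtain ⟨S₀, h₀, hrun⟩ := h
  induction hrun with
  | refl => exact h₀.isComplete
  | tail _ h ih => exact ih.iteration h

theorem evaluatedSettled (h : P.Reachable α β S) : P.EvaluatedSettled S.evaluated := by
  obtain ⟨S₀, h₀, hrun⟩ := h
  induction hrun with
  | refl => simp [EvaluatedSettled, h₀.1]
  | tail hrun h ih => exact ih.iteration (isComplete ⟨S₀, h₀, hrun⟩) h

theorem cost_le_of_target (h : P.Reachable α β S) (hP : P.DistinctPathWeights) (hα : α ≠ 0)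
    (hr : r ∈ S.tree) (ht : r.getLast? = some P.target) (hb : budget S.evaluated r = 0)
    (hq : P.IsGeodesic S.evaluated q u) (hqb : α ≤ budget S.evaluated q) :
    P.cost r ≤ P.cost q := by
  have hw := h.isComplete.isWalk hr ht
  obtain ⟨S₀, h₀, hrun⟩ := h
  rcases hrun.cases_tail with rfl | ⟨R, hrunR, hstep⟩
  · rcases hw.eq_singleton_or_exists_edge with rfl | ⟨a, ha⟩
    · simp
    · exact absurd (budget_eq_zero_iff.1 hb _ ha) (by simp [h₀.1])
  · have hR : P.Reachable α β R := ⟨S₀, h₀, hrunR⟩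
    obtain ⟨hchosen, heval⟩ := hstep.isChosen_of_budget_eq_zero hP hα hR.isComplete
      hR.evaluatedSettled hr ht hb
    have hrem : ∀ e, P.Removed S.evaluated e → P.Removed R.evaluated e := by
      rintro e ⟨he, hc⟩
      refine ⟨(heval ▸ he).resolve_right fun hnew => hc ?_, hc⟩
      exact hw.collisionFree (mem_edges_of_mem_evaluatedOn hnew) he
    obtain ⟨x, hx, hxq⟩ := hR.isComplete.exists_isFrontier_isPrefix hP
      (hq.anti hstep.evaluated_subset hrem)
      (Or.inl (hqb.trans (Nat.cast_le.2 (budget_anti hstep.evaluated_subset q))))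
    exact (hR.isComplete.cost_le_of_isChosen hchosen hx).trans (cost_le_of_isPrefix hxq)

theorem exists_target_cost_le (h : P.Reachable α β S) (hP : P.DistinctPathWeights) (hα : α ≠ 0)
    (hhalt : P.Halted α S) (hq : P.IsGeodesic S.evaluated q u)
    (hqb : α ≤ budget S.evaluated q ∨ u = P.target) :
    ∃ r ∈ S.tree, r.getLast? = some P.target ∧ budget S.evaluated r = 0 ∧
      P.cost r ≤ P.cost q := by
  obtain ⟨x, hx, -⟩ := h.isComplete.exists_isFrontier_isPrefix hP hq hqb
  obtain ⟨r, hr, ht, hb⟩ := hhalt.resolve_right fun hnone => hnone x hx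
  refine ⟨r, hr, ht, hb, ?_⟩
  rcases hqb with hqb | rfl
  · exact h.cost_le_of_target hP hα hr ht hb hq hqb
  · exact (h.isComplete.isGeodesic_of_budget_eq_zero hP hα h.evaluatedSettled hr ht hb).cost_le q
      hq.isWalk

end Reachable

theorem IsGeodesic.budget_lt_of_mem_evaluatedOn {w : V} (hp : P.IsGeodesic A p w)
    (hP : P.DistinctPathWeights) (hAB : A ⊆ B) (hB : P.EvaluatedSettled B)
    (he : e ∈ P.evaluatedOn β A p) (heB : e ∉ B) :
    P.IsGeodesic B p w ∧ budget A p < budget B p + β := by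
  obtain ⟨q, hu, hqp, hlen, hq⟩ := hp.isWalk.exists_isPrefix_of_mem_evaluatedOn he
  refine ⟨hp.mono hAB (hp.not_removed_of_notMem hP hAB hB hu hqp (fun e he => (hq e he).1) heB), ?_⟩
  have := length_edges_le_of_notMem hu hqp heB
  omega

theorem IsChosen.evaluatedOn_subset {α₁ α₂ : ℕ∞} {β₁ β₂ : ℕ} {S₁ S₂ : State V}
    (hp : P.IsChosen α₁ S₁ p) (hP : P.DistinctPathWeights) (hα₂ : α₂ ≠ 0)
    (hα : α₂ + (β₁ : ℕ∞) ≤ α₁ + 1) (hS₁ : P.IsComplete α₁ S₁) (hS₂ : P.Reachable α₂ β₂ S₂)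
    (hhalt : P.Halted α₂ S₂) (hsub : S₁.evaluated ⊆ S₂.evaluated) :
    P.evaluatedOn β₁ S₁.evaluated p ⊆ S₂.evaluated := by
  intro e he
  by_contra heB
  obtain ⟨w, hw⟩ := hS₁.isSearchTree.exists_isWalk p hp.1.1
  obtain ⟨hg, hlt⟩ := (hS₁.isGeodesic_of_isChosen hp hw.getLast?).budget_lt_of_mem_evaluatedOn hP
    hsub hS₂.evaluatedSettled he heB
  have hbudget : α₂ ≤ budget S₂.evaluated p ∨ w = P.target := by
    refine hp.1.2.imp (fun hb => ?_) fun ht => by simpa [hw.getLast?] using ht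
    refine (ENat.add_le_add_iff_right (ENat.natCast_ne_top β₁)).1 (hα.trans ?_)
    rw [← hb]
    exact_mod_cast hlt
  obtain ⟨z, hz, hzt, hzb, hzp⟩ := hS₂.exists_target_cost_le hP hα₂ hhalt hg hbudget
  have hzw := hS₂.isComplete.isWalk hz hzt
  have hzp' : z = p := hP z p
    (hzw.isSimplePathFromSource (hS₂.isComplete.isSearchTree.nodup z hz)) hg.isSimplePathFromSource
    (hzp.antisymm (hS₁.cost_le_of_isWalk_target hp (hzw.anti hsub)))
  exact heB (budget_eq_zero_iff.1 hzb e (hzp' ▸ mem_edges_of_mem_evaluatedOn he))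

theorem LRAStarEvaluates.subset {α₁ α₂ : ℕ∞} {β₁ β₂ : ℕ} {E₁ E₂ : Set (V × V)}
    (h₁ : P.LRAStarEvaluates α₁ β₁ E₁) (h₂ : P.LRAStarEvaluates α₂ β₂ E₂)
    (hP : P.DistinctPathWeights) (hα₂ : α₂ ≠ 0) (hα : α₂ + (β₁ : ℕ∞) ≤ α₁ + 1) : E₁ ⊆ E₂ := by
  obtain ⟨S₀, S, hS₀, hrun, -, rfl⟩ := h₁
  obtain ⟨T₀, T, hT₀, hrunT, hhalt, rfl⟩ := h₂
  induction hrun with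
  | refl => simp [hS₀.1]
  | tail hrun hstep ih =>
    obtain ⟨p, hp, hS'⟩ := hstep.exists_isChosen
    rw [hS']
    exact Set.union_subset ih (hp.evaluatedOn_subset hP hα₂ hα
      (Reachable.isComplete ⟨S₀, hS₀, hrun⟩) ⟨T₀, hT₀, hrunT⟩ hhalt ih)

theorem IsComplete.exists_iteration [Finite V] (hS : P.IsComplete α S) (hβ : 1 ≤ β) (hα : α ≠ 0)
    (h : ¬ P.Halted α S) : ∃ S', P.Iteration α β S S' ∧ S.evaluated ⊂ S'.evaluated := by
  obtain ⟨hnot, hne⟩ : ¬ P.TargetReached S ∧ {p | P.IsFrontier α S p}.Nonempty := by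
    simpa [Halted, Set.Nonempty] using h
  obtain ⟨p, hp, hmin⟩ := Set.exists_min_image _ (P.key S.evaluated)
    (hS.isSearchTree.finite.subset fun p hp => hp.1) hne
  have hb : budget S.evaluated p ≠ 0 := fun h0 => by
    rcases hp.2 with hb | ht
    · exact hα (by simpa [h0] using hb.symm)
    · exact hnot ⟨p, hp.1, ht, h0⟩
  obtain ⟨e, he, heA⟩ := P.exists_mem_evaluatedOn_notMem hβ hb
  have hsub : S.evaluated ⊆ S.evaluated ∪ P.evaluatedOn β S.evaluated p := Set.subset_union_left
  obtain ⟨T, hT⟩ := (hS.isSearchTree.prune hsub).exists_extends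
  exact ⟨⟨T, _⟩, ⟨hnot, p, hp, hmin, rfl, hT⟩, hsub, fun hle => heA (hle (Or.inr he))⟩

theorem IsComplete.exists_halted [Finite V] (hS : P.IsComplete α S) (hβ : 1 ≤ β) (hα : α ≠ 0) :
    ∃ S', Relation.ReflTransGen (P.Iteration α β) S S' ∧ P.Halted α S' := by
  induction hA : S.evaluated using (wellFounded_gt (α := Set (V × V))).induction
    generalizing S with
  | _ A ih =>
    subst hA
    by_cases h : P.Halted α S
    · exact ⟨S, .refl, h⟩
    · obtain ⟨S₁, h₁, hlt⟩ := hS.exists_iteration hβ hα h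
      obtain ⟨S', h', hhalt⟩ := ih S₁.evaluated hlt (hS.iteration h₁) rfl
      exact ⟨S', .head h₁ h', hhalt⟩

theorem exists_lraStarEvaluates [Finite V] (P : LazyProblem V) (hβ : 1 ≤ β) (hα : α ≠ 0) :
    ∃ E, P.LRAStarEvaluates α β E := by
  obtain ⟨T, hT⟩ := (IsSearchTree.singleton P α ∅).exists_extends
  have hS : P.IsInitial α ⟨T, ∅⟩ := ⟨rfl, hT⟩
  obtain ⟨S, h, hhalt⟩ := hS.isComplete.exists_halted hβ hα
  exact ⟨S.evaluated, _, S, hS, h, hhalt, rfl⟩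

end States

end LazyProblem

theorem mainTheorem8_general {V : Type*} (P : LazyProblem V) (hP : P.DistinctPathWeights)
    (β₁ β₂ : ℕ) (hβ₁ : 1 ≤ β₁) (hβ₂ : 1 ≤ β₂) (α₁ α₂ : ℕ∞) (hα₂ : 1 ≤ α₂)
    (hα : α₂ + (β₁ : ℕ∞) ≤ α₁ + 1) :
    (Finite V → (∃ E₁, P.LRAStarEvaluates α₁ β₁ E₁) ∧ ∃ E₂, P.LRAStarEvaluates α₂ β₂ E₂) ∧
      ∀ E₁ E₂, P.LRAStarEvaluates α₁ β₁ E₁ → P.LRAStarEvaluates α₂ β₂ E₂ → E₁ ⊆ E₂ := by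
  have hα₂' : α₂ ≠ 0 := Order.one_le_iff_ne_zero.1 hα₂
  have hα₁ : α₁ ≠ 0 := by
    rintro rfl
    simpa [one_add_one_eq_two] using (add_le_add hα₂ (Nat.one_le_cast.2 hβ₁)).trans hα
  exact ⟨fun _ => ⟨P.exists_lraStarEvaluates hβ₁ hα₁, P.exists_lraStarEvaluates hβ₂ hα₂'⟩,
    fun _ _ h₁ h₂ => h₁.subset h₂ hP hα₂' hα⟩

theorem mainTheorem8 {V : Type*} [Finite V] (P : LazyProblem V) (hP : P.DistinctPathWeights)
    (β : ℕ) (hβ : 1 ≤ β) (α₁ α₂ : ℕ∞) (h₁₂ : α₂ < α₁) (h₂β : (β : ℕ∞) ≤ α₂)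
    (hα : α₂ + (β : ℕ∞) ≤ α₁ + 1) :
    (∃ E₁, P.LRAStarEvaluates α₁ β E₁) ∧ (∃ E₂, P.LRAStarEvaluates α₂ β E₂) ∧
      ∀ E₁ E₂, P.LRAStarEvaluates α₁ β E₁ → P.LRAStarEvaluates α₂ β E₂ → E₁ ⊆ E₂ := by
  have h := mainTheorem8_general P hP β β hβ hβ α₁ α₂ ((Nat.one_le_cast.2 hβ).trans h₂β) hα
  exact ⟨(h.1 inferInstance).1, (h.1 inferInstance).2, h.2⟩
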